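/- Let $k$ be a field and $\lambda\in k$. An associative $\lambda$-differential algebra over $k$ is an associative (not necessarily unital) $k$-algebra $R$ together with a $k$-linear map $D:R\to R$ such that $D(xy)=D(x)y+xD(y)+\lambda D(x)D(y)$ for all $x,y\in R$. A subset $Y\subseteq R$ generates $R$ if the only $k$-subalgebra of $R$ that contains $Y$ and is closed under $D$ is $R$ itself; $R$ is countably generated if it is generated by a countable (possibly finite) set, and two-generated if it is generated by two distinct elements. An embedding is an injective homomorphism of $k$-algebras that commutes with the operators $D$. Every countably generated associative $\lambda$-differential algebra $A$ over $k$ can be embedded into a two-generated associative $\lambda$-differential algebra over $k$ (with the same $\lambda$). More precisely, for every sequence $x_1,x_2,\dots$ of elements of $A$ that generates $A$ (repetitions allowed), there are an associative $\lambda$-differential algebra $B$ over $k$ generated by two distinct elements $a,b$ and an embedding $f:A\to B$ such that $aab^{i}ab=f(x_i)$ for all $i\ge 1$. -/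

import Mathlib

universe u v

namespace LambdaDiff

section

variable {k : Type*} [Field k] {A : Type*} [NonUnitalRing A] [Module k A]

/-- `D` is a `lam`-derivation: `D (x y) = D x y + x D y + lam D x D y`.  An associative
`lam`-differential algebra over `k` is an associative `k`-algebra (a unit is not required)
together with a `k`-linear operator `D` with this property. -/
def IsLambdaDerivation (lam : k) (D : A →ₗ[k] A) : Prop :=
  ∀ x y : A, D (x * y) = D x * y + x * D y + lam • (D x * D y)

/-- The set `s` generates `A` as a `lam`-differential algebra: the only subalgebra that contains
`s` and is closed under the operator `D` is `A` itself. -/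
def Generates (D : A →ₗ[k] A) (s : Set A) : Prop :=
  ∀ S : NonUnitalSubalgebra k A, s ⊆ S → (∀ x ∈ S, D x ∈ S) → ∀ x : A, x ∈ S

/-- Generated, as a `lam`-differential algebra, by a countable (possibly finite) set. -/
def IsCountablyGenerated (D : A →ₗ[k] A) : Prop :=
  ∃ s : Set A, s.Countable ∧ Generates D s

/-- Generated, as a `lam`-differential algebra, by two distinct elements. -/
def IsTwoGenerated (D : A →ₗ[k] A) : Prop :=
  ∃ a b : A, a ≠ b ∧ Generates D {a, b}

/-- An embedding of algebras with one operator: an injective homomorphism of (not necessarily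
unital) `k`-algebras that commutes with the operators. -/
def IsEmbedding {B : Type*} [NonUnitalRing B] [Module k B]
    (DA : A →ₗ[k] A) (DB : B →ₗ[k] B) (f : A →ₙₐ[k] B) : Prop :=
  Function.Injective f ∧ ∀ x : A, f (DA x) = DB (f x)

end

/-- The product `a a b^i a b`; the power is written as iterated left multiplication by `b`, as
there need not be a unit. -/
def word {B : Type*} [Mul B] (a b : B) (i : ℕ) : B :=
  a * a * (fun y => b * y)^[i] (a * b)

end LambdaDiff

/-! Adjoin a unit killed by `D`, giving `R`, and let `D` act entrywise on row-finite `ℕ × ℕ`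
matrices over `R`. This is again a `lam`-derivation, and `R` embeds as the matrices supported in the
corner (`isEmbedding_cornerHom`). Two matrices `a`, `b` can be chosen so that `a a b^i a b` has `x
i` in the corner and zeros elsewhere (`secondGen_mul_firstGen_mul`). The differential subalgebra on
`a`, `b` then contains every generator of `A`, hence the image of `A`. -/

namespace LambdaDiff

/-! ### Adjoining a unit -/

section Unitization

variable {k : Type*} [Field k] {A : Type*} [NonUnitalRing A] [Module k A]

/-- The extension of an operator to the unitization that kills the unit. -/
noncomputable def unitizationMap (D : A →ₗ[k] A) : Unitization k A →ₗ[k] Unitization k A :=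
  Unitization.inrHom k k A ∘ₗ D ∘ₗ Unitization.sndHom k k A

theorem unitizationMap_apply (D : A →ₗ[k] A) (r : Unitization k A) :
    unitizationMap D r = (D r.snd : A) := rfl

theorem IsLambdaDerivation.unitizationMap [IsScalarTower k A A] [SMulCommClass k A A]
    {lam : k} {D : A →ₗ[k] A} (hD : IsLambdaDerivation lam D) :
    IsLambdaDerivation lam (unitizationMap D) := by
  intro r s
  simp only [unitizationMap_apply]
  ext
  · simp
  · simp only [Unitization.snd_mul, Unitization.snd_add, Unitization.snd_smul,
      Unitization.fst_inr, Unitization.snd_inr, map_add, map_smul, hD r.snd s.snd, zero_smul]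
    module

end Unitization

/-! ### Entrywise operators on row-finite matrices -/

section RowFinite

variable {k : Type*} [Field k] {R : Type*} [Ring R] [Algebra k R] {ι : Type*}

/-- The coordinatewise action of an operator on finitely supported vectors. -/
noncomputable def coordMap (d : R →ₗ[k] R) : (ι →₀ R) →ₗ[k] (ι →₀ R) :=
  Finsupp.mapRange.linearMap d

theorem coordMap_apply (d : R →ₗ[k] R) (v : ι →₀ R) (i : ι) : coordMap d v i = d (v i) := rfl

theorem coordMap_single (d : R →ₗ[k] R) (i : ι) (r : R) :
    coordMap d (Finsupp.single i r) = Finsupp.single i (d r) := by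
  simp [coordMap]

theorem coordMap_smul {lam : k} {d : R →ₗ[k] R} (hd : IsLambdaDerivation lam d)
    (r : R) (v : ι →₀ R) :
    coordMap d (r • v) = d r • v + r • coordMap d v + lam • (d r • coordMap d v) := by
  ext i
  simp [coordMap_apply, hd r (v i)]

/-- An operator on `R` acts entrywise on row-finite matrices, seen as endomorphisms of a free
module. -/
noncomputable def entrywise (d : R →ₗ[k] R) :
    Module.End R (ι →₀ R) →ₗ[k] Module.End R (ι →₀ R) where
  toFun T := Finsupp.linearCombination R fun i => coordMap d (T (Finsupp.single i 1))
  map_add' S T := by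
    refine Finsupp.lhom_ext' fun i => LinearMap.ext_ring ?_
    simp
  map_smul' c T := by
    refine Finsupp.lhom_ext' fun i => LinearMap.ext_ring ?_
    simp

theorem entrywise_apply_single (d : R →ₗ[k] R) (T : Module.End R (ι →₀ R)) (i : ι) :
    entrywise d T (Finsupp.single i 1) = coordMap d (T (Finsupp.single i 1)) := by
  simp [entrywise]

/-- Expanding `v` in the basis reduces this to the rule in `R` for a coefficient times a matrix
entry. Coefficients stand on the left, so `R` need not be commutative. -/
theorem coordMap_apply_end {lam : k} {d : R →ₗ[k] R} (hd : IsLambdaDerivation lam d)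
    (T : Module.End R (ι →₀ R)) (v : ι →₀ R) :
    coordMap d (T v) =
      T (coordMap d v) + entrywise d T v + lam • entrywise d T (coordMap d v) := by
  induction v using Finsupp.induction_linear with
  | zero => simp
  | add v w hv hw => simp only [map_add, hv, hw, smul_add]; abel
  | single i r =>
    have h (S : Module.End R (ι →₀ R)) (s : R) :
        S (Finsupp.single i s) = s • S (Finsupp.single i 1) := by
      rw [← map_smul, Finsupp.smul_single, smul_eq_mul, mul_one]
    rw [coordMap_single, h T r, h T (d r), h _ r, h _ (d r), coordMap_smul hd,
      entrywise_apply_single]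

theorem IsLambdaDerivation.entrywise {lam : k} {d : R →ₗ[k] R} (hd : IsLambdaDerivation lam d) :
    IsLambdaDerivation (A := Module.End R (ι →₀ R)) lam (entrywise d) := by
  intro S T
  refine Finsupp.lhom_ext' fun i => LinearMap.ext_ring ?_
  simp only [LinearMap.comp_apply, Finsupp.lsingle_apply, LinearMap.add_apply,
    LinearMap.smul_apply, Module.End.mul_apply, entrywise_apply_single, coordMap_apply_end hd S]
  abel

end RowFinite

/-! ### Opposite algebras: composing endomorphisms of a left module reverses the matrix product -/

section Opposite

variable {k : Type*} [Field k] {E : Type*} [NonUnitalRing E] [Module k E]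

/-- An operator, seen on the opposite algebra. -/
def opMap (D : E →ₗ[k] E) : Eᵐᵒᵖ →ₗ[k] Eᵐᵒᵖ :=
  (MulOpposite.opLinearEquiv k).toLinearMap ∘ₗ D ∘ₗ (MulOpposite.opLinearEquiv k).symm.toLinearMap

theorem opMap_op (D : E →ₗ[k] E) (x : E) : opMap D (MulOpposite.op x) = MulOpposite.op (D x) := rfl

theorem IsLambdaDerivation.opMap {lam : k} {D : E →ₗ[k] E} (hD : IsLambdaDerivation lam D) :
    IsLambdaDerivation lam (opMap D) := by
  intro x y
  induction x using MulOpposite.rec'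
  induction y using MulOpposite.rec'
  rename_i x y
  simp only [← MulOpposite.op_mul, opMap_op, hD y x, MulOpposite.op_add, MulOpposite.op_smul]
  abel

end Opposite

/-! ### Differential subalgebras -/

section Closure

variable {k : Type*} [Field k] {E : Type*} [NonUnitalRing E] [Module k E]
  [IsScalarTower k E E] [SMulCommClass k E E]

/-- The smallest subalgebra that contains `s` and is closed under `D`. -/
def differentialClosure (D : E →ₗ[k] E) (s : Set E) : NonUnitalSubalgebra k E :=
  sInf {S | s ⊆ S ∧ ∀ x ∈ S, D x ∈ S}

theorem subset_differentialClosure (D : E →ₗ[k] E) (s : Set E) :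
    s ⊆ differentialClosure D s := fun _ hx =>
  NonUnitalAlgebra.mem_sInf.2 fun _ hS => hS.1 hx

theorem map_mem_differentialClosure (D : E →ₗ[k] E) (s : Set E) {x : E}
    (hx : x ∈ differentialClosure D s) : D x ∈ differentialClosure D s :=
  NonUnitalAlgebra.mem_sInf.2 fun S hS => hS.2 x (NonUnitalAlgebra.mem_sInf.1 hx S hS)

theorem differentialClosure_le {D : E →ₗ[k] E} {s : Set E} {S : NonUnitalSubalgebra k E}
    (hs : s ⊆ S) (hS : ∀ x ∈ S, D x ∈ S) : differentialClosure D s ≤ S :=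
  sInf_le ⟨hs, hS⟩

/-- The restriction of `D` to the closure of `s`. -/
def closureMap (D : E →ₗ[k] E) (s : Set E) :
    differentialClosure D s →ₗ[k] differentialClosure D s where
  toFun x := ⟨D x, map_mem_differentialClosure D s x.2⟩
  map_add' x y := Subtype.ext (map_add D (x : E) y)
  map_smul' c x := Subtype.ext (map_smul D c (x : E))

theorem IsLambdaDerivation.closureMap {lam : k} {D : E →ₗ[k] E} (hD : IsLambdaDerivation lam D)
    (s : Set E) : IsLambdaDerivation lam (closureMap D s) := fun x y =>
  Subtype.ext (hD x y)

theorem generates_closureMap (D : E →ₗ[k] E) (s : Set E) :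
    Generates (closureMap D s) (Subtype.val ⁻¹' s) := by
  intro S hs hS x
  -- Pushed forward to `E`, `S` competes in the infimum that defines the closure.
  have hle : differentialClosure D s ≤
      S.map (NonUnitalSubalgebraClass.subtype (differentialClosure D s)) := by
    refine differentialClosure_le (fun y hy => ?_) ?_
    · exact ⟨⟨y, subset_differentialClosure D s hy⟩, hs hy, rfl⟩
    · rintro _ ⟨y, hy, rfl⟩
      exact ⟨closureMap D s y, hS y hy, rfl⟩
  obtain ⟨y, hy, hyx⟩ := hle x.2
  rwa [Subtype.ext (show (y : E) = x from hyx)] at hy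

/-- If an algebra `E` with operator contains `A` and two elements whose words `a a b^i a b` are
the given generators of `A`, then `A` embeds into the differential subalgebra on these two. -/
theorem exists_two_generated_of_word {lam : k}
    {A : Type*} [NonUnitalRing A] [Module k A] {D : A →ₗ[k] A} {DE : E →ₗ[k] E}
    (hDE : IsLambdaDerivation lam DE) {g : A →ₙₐ[k] E} (hg : IsEmbedding D DE g)
    {x : ℕ+ → A} (hx : Generates D (Set.range x)) {a b : E} (hab : a ≠ b)
    (hw : ∀ i : ℕ+, word a b i = g (x i)) :
    ∃ (f : A →ₙₐ[k] differentialClosure DE {a, b}) (a' b' : differentialClosure DE {a, b}),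
      IsLambdaDerivation lam (closureMap DE {a, b}) ∧ a' ≠ b' ∧
      Generates (closureMap DE {a, b}) {a', b'} ∧ IsEmbedding D (closureMap DE {a, b}) f ∧
      ∀ i : ℕ+, word a' b' i = f (x i) := by
  set C := differentialClosure DE {a, b} with hC
  let a' : C := ⟨a, subset_differentialClosure DE _ (by simp)⟩
  let b' : C := ⟨b, subset_differentialClosure DE _ (by simp)⟩
  have hword (i : ℕ) : ((word a' b' i : C) : E) = word a b i := by
    have h : Function.Semiconj (Subtype.val : C → E) (b' * ·) (b * ·) := fun _ => rfl
    have := h.iterate_right i (a' * b')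
    exact congrArg (a * a * ·) this
  have hmem (y : A) : g y ∈ C := by
    -- The preimage of `C` is a differential subalgebra of `A`; it contains each `x i` because `g (x
    -- i)` is a word in `a`, `b`.
    refine hx (C.comap g) ?_ (fun z hz => ?_) y
    · rintro _ ⟨i, rfl⟩
      change g (x i) ∈ C
      rw [← hw i, ← hword]
      exact (word a' b' i).2
    · change g (D z) ∈ C
      rw [hg.2]
      exact map_mem_differentialClosure DE _ hz
  refine ⟨NonUnitalAlgHom.codRestrict g C hmem, a', b', hDE.closureMap _,
    fun h => hab (congrArg Subtype.val h), ?_, ⟨fun y z h => hg.1 (congrArg Subtype.val h),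
    fun y => Subtype.ext (hg.2 y)⟩, fun i => Subtype.ext ((hword i).trans (hw i))⟩
  have h := generates_closureMap DE {a, b}
  convert h using 1
  ext y
  simp [a', b', Subtype.ext_iff]

end Closure

/-! ### The two generating matrices -/

section Construction

variable {R : Type*} [Ring R]

/-- The endomorphism that sends `e 0` to `e 1`, `e 1` to `e 3`, `e 2` to `0` and `e (j + 3)` to
`x j • e 2`. -/
noncomputable def firstGen (x : ℕ → R) : Module.End R (ℕ →₀ R) :=
  Finsupp.linearCombination R fun
    | 0 => Finsupp.single 1 1
    | 1 => Finsupp.single 3 1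
    | 2 => 0
    | j + 3 => Finsupp.single 2 (x j)

/-- The endomorphism that sends `e 2` to `e 0`, `e (j + 3)` to `e (j + 4)`, and `e 0` and `e 1`
to `0`. -/
noncomputable def secondGen : Module.End R (ℕ →₀ R) :=
  Finsupp.linearCombination R fun
    | 0 => 0
    | 1 => 0
    | 2 => Finsupp.single 0 1
    | j + 3 => Finsupp.single (j + 4) 1

/-- The matrix whose only entry is `r`, in the corner. -/
noncomputable def corner (r : R) : Module.End R (ℕ →₀ R) :=
  Finsupp.linearCombination R fun
    | 0 => Finsupp.single 0 r
    | _ + 1 => 0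

theorem firstGen_zero (x : ℕ → R) (r : R) :
    firstGen x (Finsupp.single 0 r) = Finsupp.single 1 r := by simp [firstGen]

theorem firstGen_one (x : ℕ → R) (r : R) :
    firstGen x (Finsupp.single 1 r) = Finsupp.single 3 r := by simp [firstGen]

theorem firstGen_two (x : ℕ → R) (r : R) :
    firstGen x (Finsupp.single 2 r) = 0 := by simp [firstGen]

theorem firstGen_add_three (x : ℕ → R) (j : ℕ) (r : R) :
    firstGen x (Finsupp.single (j + 3) r) = Finsupp.single 2 (r * x j) := by simp [firstGen]

theorem secondGen_one (r : R) : secondGen (Finsupp.single 1 r) = 0 := by simp [secondGen]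

theorem secondGen_two (r : R) :
    secondGen (Finsupp.single 2 r) = Finsupp.single 0 r := by simp [secondGen]

theorem secondGen_add_three (j : ℕ) (r : R) :
    secondGen (Finsupp.single (j + 3) r) = Finsupp.single (j + 4) r := by simp [secondGen]

theorem corner_zero (r s : R) :
    corner r (Finsupp.single 0 s) = Finsupp.single 0 (s * r) := by simp [corner]

theorem corner_succ (r s : R) (j : ℕ) :
    corner r (Finsupp.single (j + 1) s) = 0 := by simp [corner]

theorem secondGen_pow_three (i : ℕ) (r : R) :
    (secondGen ^ i) (Finsupp.single 3 r) = Finsupp.single (i + 3) r := by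
  induction i with
  | zero => simp
  | succ i ih => rw [pow_succ', Module.End.mul_apply, ih, secondGen_add_three, add_right_comm]

/-- The path is `e 0 ↦ e 1 ↦ e 3 ↦ e (i + 3) ↦ x i • e 2 ↦ e 0`. Two applications of `firstGen x`
already kill every other basis vector, `e 1` because `x 0 = 0`. -/
theorem secondGen_mul_firstGen_mul (x : ℕ → R) (hx : x 0 = 0) (i : ℕ) :
    secondGen * firstGen x * secondGen ^ i * firstGen x * firstGen x = corner (x i) := by
  refine Finsupp.lhom_ext' fun n => LinearMap.ext_ring ?_
  simp only [LinearMap.comp_apply, Finsupp.lsingle_apply, Module.End.mul_apply]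
  match n with
  | 0 => rw [firstGen_zero, firstGen_one, secondGen_pow_three, firstGen_add_three, secondGen_two,
      corner_zero]
  | 1 => rw [firstGen_one, ← zero_add 3, firstGen_add_three, hx]; simp [corner_succ _ _ 0]
  | 2 => rw [firstGen_two]; simp [corner_succ _ _ 1]
  | j + 3 => rw [firstGen_add_three, firstGen_two, corner_succ]; simp

theorem word_op_eq {E : Type*} [Ring E] (a b : E) (i : ℕ) :
    word (MulOpposite.op a) (MulOpposite.op b) i = MulOpposite.op (b * a * b ^ i * a * a) := by
  simp only [word, mul_left_iterate, MulOpposite.op_mul, MulOpposite.op_pow, mul_assoc]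

theorem firstGen_ne_secondGen [Nontrivial R] (x : ℕ → R) : firstGen x ≠ secondGen := by
  intro h
  have := LinearMap.congr_fun h (Finsupp.single 1 1)
  rw [firstGen_one, secondGen_one] at this
  simp at this

variable {k : Type*} [Field k]

theorem entrywise_corner [Algebra k R] (d : R →ₗ[k] R) (r : R) :
    entrywise d (corner r) = corner (d r) := by
  refine Finsupp.lhom_ext' fun n => LinearMap.ext_ring ?_
  simp only [LinearMap.comp_apply, Finsupp.lsingle_apply, entrywise_apply_single]
  cases n with
  | zero => simp only [corner_zero, one_mul, coordMap_single]
  | succ n => simp only [corner_succ, map_zero]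

/-- The corner embedding of an algebra into the row-finite matrices. -/
noncomputable def cornerHom [Algebra k R] : R →ₙₐ[k] (Module.End R (ℕ →₀ R))ᵐᵒᵖ where
  toFun r := MulOpposite.op (corner r)
  map_smul' c r := by
    refine congrArg MulOpposite.op (Finsupp.lhom_ext' fun n => LinearMap.ext_ring ?_)
    cases n <;> simp [corner]
  map_zero' := by
    refine congrArg MulOpposite.op (Finsupp.lhom_ext' fun n => LinearMap.ext_ring ?_)
    cases n <;> simp [corner]
  map_add' r s := by
    refine congrArg MulOpposite.op (Finsupp.lhom_ext' fun n => LinearMap.ext_ring ?_)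
    cases n <;> simp [corner]
  map_mul' r s := by
    refine congrArg MulOpposite.op (Finsupp.lhom_ext' fun n => LinearMap.ext_ring ?_)
    cases n <;> simp [corner]

theorem isEmbedding_cornerHom [Algebra k R] (d : R →ₗ[k] R) :
    IsEmbedding (B := (Module.End R (ℕ →₀ R))ᵐᵒᵖ) d (opMap (entrywise d)) cornerHom := by
  refine ⟨fun r s h => ?_, fun r => congrArg MulOpposite.op (entrywise_corner d r).symm⟩
  have := LinearMap.congr_fun (MulOpposite.op_injective h) (Finsupp.single 0 1)
  rwa [corner_zero, corner_zero, one_mul, one_mul, (Finsupp.single_injective 0).eq_iff] at this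

end Construction

theorem IsCountablyGenerated.exists_generates_range {k : Type*} [Field k] {A : Type*}
    [NonUnitalRing A] [Module k A] {D : A →ₗ[k] A} (h : IsCountablyGenerated D) :
    ∃ x : ℕ+ → A, Generates D (Set.range x) := by
  obtain ⟨s, hs, hgen⟩ := h
  -- Inserting `0` covers the case of an empty generating set.
  obtain ⟨x, hx⟩ := (hs.insert 0).exists_eq_range (Set.insert_nonempty 0 s)
  refine ⟨x ∘ Equiv.pnatEquivNat, fun S hS => hgen S fun y hy => hS ?_⟩
  rw [Equiv.pnatEquivNat.surjective.range_comp, ← hx]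
  exact Set.mem_insert_of_mem 0 hy

theorem exists_embedding_of_generates {k : Type v} [Field k] {lam : k}
    {A : Type u} [NonUnitalRing A] [Module k A] [IsScalarTower k A A] [SMulCommClass k A A]
    {D : A →ₗ[k] A} (hD : IsLambdaDerivation lam D) {x : ℕ+ → A}
    (hx : Generates D (Set.range x)) :
    ∃ (B : Type (max u v)) (_ : NonUnitalRing B) (_ : Module k B)
      (_ : IsScalarTower k B B) (_ : SMulCommClass k B B)
      (DB : B →ₗ[k] B) (f : A →ₙₐ[k] B) (a b : B),
      IsLambdaDerivation lam DB ∧ a ≠ b ∧ Generates DB {a, b} ∧ IsEmbedding D DB f ∧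
      ∀ i : ℕ+, word a b (i : ℕ) = f (x i) := by
  let d := unitizationMap D
  -- Generators are indexed from `1`, so index `0` is free to hold the value `0`.
  let y (n : ℕ) : Unitization k A := if h : 0 < n then (x ⟨n, h⟩ : A) else 0
  let g : A →ₙₐ[k] (Module.End (Unitization k A) (ℕ →₀ Unitization k A))ᵐᵒᵖ :=
    cornerHom.comp (Unitization.inrNonUnitalAlgHom k A)
  have hg : IsEmbedding (B := (Module.End (Unitization k A) (ℕ →₀ Unitization k A))ᵐᵒᵖ)
      D (opMap (entrywise d)) g := by
    refine ⟨(isEmbedding_cornerHom d).1.comp Unitization.inr_injective, fun z => ?_⟩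
    exact (isEmbedding_cornerHom d).2 z
  have hw (i : ℕ+) : word (MulOpposite.op (firstGen y)) (MulOpposite.op secondGen) i = g (x i) := by
    refine (word_op_eq (firstGen y) secondGen i).trans ?_
    rw [secondGen_mul_firstGen_mul y (by simp [y])]
    simp only [y, i.pos, dif_pos]
    rfl
  obtain ⟨f, a, b, h⟩ := exists_two_generated_of_word hD.unitizationMap.entrywise.opMap hg hx
    (MulOpposite.op_injective.ne (firstGen_ne_secondGen y)) hw
  exact ⟨_, _, _, inferInstance, inferInstance, closureMap _ _, f, a, b, h⟩

end LambdaDiff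

theorem mainTheorem12 {k : Type v} [Field k] (lam : k)
    {A : Type u} [NonUnitalRing A] [Module k A] [IsScalarTower k A A] [SMulCommClass k A A]
    (D : A →ₗ[k] A) (hD : LambdaDiff.IsLambdaDerivation lam D)
    (hA : LambdaDiff.IsCountablyGenerated D) :
    (∃ (B : Type (max u v)) (_ : NonUnitalRing B) (_ : Module k B)
        (_ : IsScalarTower k B B) (_ : SMulCommClass k B B)
        (DB : B →ₗ[k] B) (f : A →ₙₐ[k] B),
        LambdaDiff.IsLambdaDerivation lam DB ∧ LambdaDiff.IsTwoGenerated DB ∧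
        LambdaDiff.IsEmbedding D DB f) ∧
    (∀ x : ℕ+ → A, LambdaDiff.Generates D (Set.range x) →
      ∃ (B : Type (max u v)) (_ : NonUnitalRing B) (_ : Module k B)
        (_ : IsScalarTower k B B) (_ : SMulCommClass k B B)
        (DB : B →ₗ[k] B) (f : A →ₙₐ[k] B) (a b : B),
        LambdaDiff.IsLambdaDerivation lam DB ∧
        a ≠ b ∧ LambdaDiff.Generates DB {a, b} ∧
        LambdaDiff.IsEmbedding D DB f ∧
        ∀ i : ℕ+, LambdaDiff.word a b (i : ℕ) = f (x i)) := by
  refine ⟨?_, fun x hx => LambdaDiff.exists_embedding_of_generates hD hx⟩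
  obtain ⟨x, hx⟩ := hA.exists_generates_range
  obtain ⟨B, i₁, i₂, i₃, i₄, DB, f, a, b, h, hab, hgen, hf, -⟩ :=
    LambdaDiff.exists_embedding_of_generates hD hx
  exact ⟨B, i₁, i₂, i₃, i₄, DB, f, h, ⟨a, b, hab, hgen⟩, hf⟩
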